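/- Let $F$ be a closed convex function of class $C^3$ on an open convex set $\operatorname{dom}F\subset\mathbb R^n$ (closed: its epigraph $\{(x,t): x\in\operatorname{dom}F,\ F(x)\le t\}$ is closed in $\mathbb R^n\times\mathbb R$). Suppose that $F$ is self-concordant with the normalized constant $2$, i.e. $D^3F(x)[u,u,u]\le 2\,(\nabla^2F(x)u,u)^{3/2}$ for all $x\in\operatorname{dom}F$, $u\in\mathbb R^n$, and that $F$ is nondegenerate: $\operatorname{dom}F$ contains no straight line or, alternatively, $\nabla^2F$ is positive definite on $\operatorname{dom}F$. Then $\nabla^2F(x)$ is positive definite for every $x\in\operatorname{dom}F$, and with the Newton decrement $\lambda(x)=(\nabla^2F(x)^{-1}\nabla F(x),\nabla F(x))^{1/2}=\|\nabla F(x)\|_x^*$ the following holds. (a) If $x\in\operatorname{dom}F$ and $\lambda(x)<1$, then $\hat x=x-\nabla^2F(x)^{-1}\nabla F(x)$ belongs to $\operatorname{dom}F$, and $$\lambda(\hat x)\le\left(\frac{\lambda(x)}{1-\lambda(x)}\right)^2 .$$ (b) (Quadratic convergence.) If $x_0\in\operatorname{dom}F$ and $\lambda(x_0)<\frac{3-\sqrt5}{2}$,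 then the Newton iterates $x_{k+1}=x_k-\nabla^2F(x_k)^{-1}\nabla F(x_k)$ satisfy, for every $k\ge0$: $x_k\in\operatorname{dom}F$, $\lambda(x_k)<\frac{3-\sqrt5}{2}$, $$\lambda(x_{k+1})\le\left(\frac{\lambda(x_k)}{1-\lambda(x_k)}\right)^2,\qquad \lambda(x_{k+1})\le\frac{\lambda(x_k)^2}{(1-\lambda(x_0))^2},$$ and $\lambda(x_{k+1})<\lambda(x_k)$ if $\lambda(x_k)>0$. Moreover $\lambda(x_k)\to0$, $F$ has a unique minimizer $x^*$ on $\operatorname{dom}F$, $x_k\to x^*$, $F(x_k)\to F(x^*)$, and there is a constant $C$ such that for all $k\ge0$ $$F(x_{k+1})-F(x^*)\le C\,(F(x_k)-F(x^*))^2,\qquad \|x_{k+1}-x^*\|\le C\,\|x_k-x^*\|^2 .$$ -/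

import Mathlib

open scoped Gradient InnerProductSpace Topology
open Filter

noncomputable section

namespace SelfConc

variable {n : ℕ}

/-- The Hessian `∇²F(x)`, as a linear operator of `ℝⁿ`: the derivative of the gradient map. -/
def hess (F : EuclideanSpace ℝ (Fin n) → ℝ) (x : EuclideanSpace ℝ (Fin n)) :
    EuclideanSpace ℝ (Fin n) →L[ℝ] EuclideanSpace ℝ (Fin n) :=
  fderiv ℝ (∇ F) x

/-- The Hessian of `F` is positive definite at `x`. -/
def HessPosDef (F : EuclideanSpace ℝ (Fin n) → ℝ) (x : EuclideanSpace ℝ (Fin n)) : Prop :=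
  ∀ u : EuclideanSpace ℝ (Fin n), u ≠ 0 → 0 < ⟪hess F x u, u⟫_ℝ

/-- `F`, with domain `s`, is a self-concordant function (with the normalized constant `M = 2`):
a closed convex function of class `C³` on an open convex set `s ⊆ ℝⁿ` such that
`D³F(x)[u,u,u] ≤ 2 (∇²F(x)u, u)^{3/2}` for all `x ∈ s` and all `u`. -/
structure SelfConcordant (s : Set (EuclideanSpace ℝ (Fin n)))
    (F : EuclideanSpace ℝ (Fin n) → ℝ) : Prop where
  isOpen_dom : IsOpen s
  convexOn : ConvexOn ℝ s F
  contDiffOn : ContDiffOn ℝ 3 F s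
  isClosed_epi : IsClosed {p : EuclideanSpace ℝ (Fin n) × ℝ | p.1 ∈ s ∧ F p.1 ≤ p.2}
  third_le : ∀ x ∈ s, ∀ u : EuclideanSpace ℝ (Fin n),
    iteratedFDeriv ℝ 3 F x (fun _ => u) ≤ 2 * ⟪hess F x u, u⟫_ℝ ^ (3 / 2 : ℝ)

/-- The set `s` contains no straight line. -/
def ContainsNoLine (s : Set (EuclideanSpace ℝ (Fin n))) : Prop :=
  ¬ ∃ x u : EuclideanSpace ℝ (Fin n), u ≠ 0 ∧ ∀ t : ℝ, x + t • u ∈ s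

/-- The Newton decrement `λ(x) = (∇²F(x)⁻¹ ∇F(x), ∇F(x))^{1/2}`. -/
def newtonDecrement (F : EuclideanSpace ℝ (Fin n) → ℝ) (x : EuclideanSpace ℝ (Fin n)) : ℝ :=
  √ ⟪(hess F x).inverse (∇ F x), ∇ F x⟫_ℝ

/-- The full Newton step `x ↦ x - ∇²F(x)⁻¹ ∇F(x)`. -/
def newtonStep (F : EuclideanSpace ℝ (Fin n) → ℝ) (x : EuclideanSpace ℝ (Fin n)) :
    EuclideanSpace ℝ (Fin n) :=
  x - (hess F x).inverse (∇ F x)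

end SelfConc

end

/-!
# Newton's method for self-concordant functions

Write `‖u‖ₓ = (∇²F(x)u, u)^{1/2}` for the local norm and `T(x)` for the third derivative of `F`.

*From the diagonal to mixed third derivatives.* Self-concordance bounds `T(x)[u,u,u]`; the Newton
step needs `|T(x)[u,v,v]| ≤ 2 ‖u‖ₓ ‖v‖ₓ²`. On the plane spanned by `u` and `v` the diagonal of `T`
is a cubic form, hence a trigonometric polynomial of degree 3 on the unit circle, and the mixed
bound is the Bernstein–Szegő inequality at a point. It follows from an explicit quadrature formula
that writes `T[u,v,v]` as a convex combination of three diagonal values (`abs_trilinear_le`).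

*Hessians along a segment.* The diagonal bound says that `1 / ‖h‖_{x+th}` has derivative at least
`-1` in `t`, so that `‖h‖_{x+th} ≤ r / (1 - t r)` with `r = ‖h‖ₓ < 1`. With the mixed bound this
gives `(1 - t r)² ∇²F(x) ≤ ∇²F(x+th) ≤ (1 - t r)⁻² ∇²F(x)` (`SelfConcordant.hess_line_bounds`). In
particular `F` stays bounded along the segment, and since its epigraph is closed the segment cannot
leave the domain (`SelfConcordant.add_mem_of_localNorm_lt_one`). The same closedness argument shows
that if `(∇²F(x)u, u) = 0`, then `F` is affine along `x + ℝu`, which lies in the domain: without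
lines in the domain the Hessian is positive definite.

*One Newton step.* If `h` is the Newton step at `x`, then `∇F(x+h) = ∫₀¹ (∇²F(x+th) - ∇²F(x))h dt`,
and the Hessian bounds give `(∇F(x+h), v) ≤ λ(x)² / (1 - λ(x)) ‖v‖ₓ`, where moreover
`‖v‖ₓ ≤ ‖v‖_{x+h} / (1 - λ(x))`. This is `SelfConcordant.newtonDecrement_newtonStep_le`.

*Convergence.* For `λ < 1`, the factor `λ / (1 - λ)²` is less than `1` exactly below the threshold
`(3 - √5) / 2`, so the decrements tend to zero there. Once `λ ≤ 1/8` the steps are geometrically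
small in a fixed local norm and remain in a ball of radius `1/2` in it, so the iterates converge
inside the domain, to a critical point `y`. In the ball `‖x - y‖_y ≤ 1/2` the quantities `λ(x)²`,
`F(x) - F(y)` and `‖x - y‖_y²` are comparable (`SelfConcordant.local_estimates`), and the
quadratic decay of `λ` carries over to the other two.
-/

namespace SelfConc

/-! ### Cubic and trilinear forms -/

/-- The Bernstein–Szegő inequality for homogeneous binary cubics: a bound for the cubic on the unit
circle bounds its polar form at `((p, q), (1, 0), (1, 0))` for unit vectors `(p, q)`. -/
theorem abs_polar_le_of_cubic_le {a b c d M : ℝ}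
    (h : ∀ C S : ℝ, C ^ 2 + S ^ 2 = 1 →
      |a * C ^ 3 + 3 * b * C ^ 2 * S + 3 * c * C * S ^ 2 + d * S ^ 3| ≤ M)
    {p q : ℝ} (hpq : p ^ 2 + q ^ 2 = 1) : |p * a + q * b| ≤ M := by
  -- `(p, q) = (cos 3t, sin 3t)` with `(C, S) = (cos t, sin t)`; the nodes of the quadrature formula
  -- are the angles `t` and `t ± 2π/3`, the maximum points of `cos (3 · - 3t)`.
  obtain ⟨C, S, hCS, hp, hq⟩ : ∃ C S : ℝ, C ^ 2 + S ^ 2 = 1 ∧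
      p = C ^ 3 - 3 * C * S ^ 2 ∧ q = 3 * C ^ 2 * S - S ^ 3 := by
    obtain ⟨θ, h1, h2⟩ : ∃ θ : ℝ, p = Real.cos θ ∧ q = Real.sin θ := by
      have hz : ‖(⟨p, q⟩ : ℂ)‖ = 1 := by
        rw [Complex.norm_def, Complex.normSq_mk, ← sq, ← sq, hpq, Real.sqrt_one]
      refine ⟨Complex.arg ⟨p, q⟩, ?_, ?_⟩
      · have := Complex.norm_mul_cos_arg ⟨p, q⟩
        rw [hz, one_mul] at this
        exact this.symm
      · have := Complex.norm_mul_sin_arg ⟨p, q⟩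
        rw [hz, one_mul] at this
        exact this.symm
    have h3 : θ = 3 * (θ / 3) := by ring
    have h4 := Real.cos_sq_add_sin_sq (θ / 3)
    refine ⟨Real.cos (θ / 3), Real.sin (θ / 3), h4, ?_, ?_⟩
    · rw [h1, h3, Real.cos_three_mul, ← h3]
      linear_combination (3 * Real.cos (θ / 3)) * h4
    · rw [h2, h3, Real.sin_three_mul, ← h3]
      linear_combination (-3 * Real.sin (θ / 3)) * h4
  have h3 : √3 ^ 2 = 3 := Real.sq_sqrt (by norm_num)
  obtain ⟨s3, hs3⟩ : ∃ s : ℝ, s = √3 := ⟨_, rfl⟩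
  rw [← hs3] at h3
  let f : ℝ → ℝ → ℝ := fun C S =>
    a * C ^ 3 + 3 * b * C ^ 2 * S + 3 * c * C * S ^ 2 + d * S ^ 3
  -- The weight at the angle `φ` is `(1 + 2 cos 2φ)² / 9`, written homogeneously.
  let w : ℝ → ℝ → ℝ := fun C S => (3 * C ^ 2 - S ^ 2) ^ 2 / 9
  let C1 := -C / 2 - s3 / 2 * S
  let S1 := -S / 2 + s3 / 2 * C
  let C2 := -C / 2 + s3 / 2 * S
  let S2 := -S / 2 - s3 / 2 * C
  have e1 : C1 ^ 2 + S1 ^ 2 = 1 := by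
    simp only [C1, S1]; linear_combination (C ^ 2 + S ^ 2) / 4 * h3 + hCS
  have e2 : C2 ^ 2 + S2 ^ 2 = 1 := by
    simp only [C2, S2]; linear_combination (C ^ 2 + S ^ 2) / 4 * h3 + hCS
  have hs4 : s3 ^ 4 = 9 := by rw [show s3 ^ 4 = (s3 ^ 2) ^ 2 by ring, h3]; norm_num
  have hs6 : s3 ^ 6 = 27 := by rw [show s3 ^ 6 = (s3 ^ 2) ^ 3 by ring, h3]; norm_num
  -- Both identities are homogeneous polynomial identities up to powers of `C² + S² = 1`.
  have hw : w C S + w C1 S1 + w C2 S2 = 1 := by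
    trans (C ^ 2 + S ^ 2) ^ 2
    · simp only [w, C1, S1, C2, S2]
      ring_nf
      simp only [h3, hs4]
      ring
    · rw [hCS]; norm_num
  have hsum : p * a + q * b = w C S * f C S + w C1 S1 * f C1 S1 + w C2 S2 * f C2 S2 := by
    trans (C ^ 2 + S ^ 2) ^ 2 * (p * a + q * b)
    · rw [hCS]; ring
    · simp only [hp, hq, f, w, C1, S1, C2, S2]
      ring_nf
      simp only [h3, hs4, hs6]
      ring
  have hw0 : ∀ C S, 0 ≤ w C S := fun C S => by positivity
  rw [hsum]
  calc |w C S * f C S + w C1 S1 * f C1 S1 + w C2 S2 * f C2 S2|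
      ≤ w C S * |f C S| + w C1 S1 * |f C1 S1| + w C2 S2 * |f C2 S2| := by
        refine (abs_add_three _ _ _).trans_eq ?_
        simp only [abs_mul, abs_of_nonneg (hw0 _ _)]
    _ ≤ w C S * M + w C1 S1 * M + w C2 S2 * M := by
        exact add_le_add (add_le_add (mul_le_mul_of_nonneg_left (h _ _ hCS) (hw0 _ _))
          (mul_le_mul_of_nonneg_left (h _ _ e1) (hw0 _ _)))
          (mul_le_mul_of_nonneg_left (h _ _ e2) (hw0 _ _))
    _ = M := by rw [← add_mul, ← add_mul, hw, one_mul]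

section InnerProduct

variable {E : Type*} [NormedAddCommGroup E] [InnerProductSpace ℝ E]

/-- Polarization: a bound of the quadratic form of `G` by that of a positive definite `A` bounds the
bilinear form of `G` with the same constant. -/
theorem abs_inner_le_of_abs_quadratic_le {A G : E →L[ℝ] E}
    (hA : ∀ u v, ⟪A u, v⟫_ℝ = ⟪A v, u⟫_ℝ) (hpos : ∀ u, u ≠ 0 → 0 < ⟪A u, u⟫_ℝ)
    (hG : ∀ u v, ⟪G u, v⟫_ℝ = ⟪G v, u⟫_ℝ) {c : ℝ} (hc : ∀ u, |⟪G u, u⟫_ℝ| ≤ c * ⟪A u, u⟫_ℝ)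
    (u v : E) : |⟪G u, v⟫_ℝ| ≤ c * (√⟪A u, u⟫_ℝ * √⟪A v, v⟫_ℝ) := by
  rcases eq_or_ne u 0 with rfl | hu
  · simp
  rcases eq_or_ne v 0 with rfl | hv
  · simp
  have hu' := Real.sqrt_pos.2 (hpos u hu)
  have hv' := Real.sqrt_pos.2 (hpos v hv)
  have hu2 := Real.sq_sqrt (hpos u hu).le
  have hv2 := Real.sq_sqrt (hpos v hv).le
  set α := √⟪A u, u⟫_ℝ
  set β := √⟪A v, v⟫_ℝ
  have h1 := hc (β • u + α • v)
  have h2 := hc (β • u - α • v)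
  simp only [map_add, map_sub, map_smul, inner_add_left, inner_add_right, inner_sub_left,
    inner_sub_right, real_inner_smul_left, real_inner_smul_right, ← hu2, ← hv2, hG v u,
    hA v u] at h1 h2
  have hαβ : 0 < α * β := mul_pos hu' hv'
  rw [abs_le] at h1 h2 ⊢
  constructor
  · refine le_of_mul_le_mul_left ?_ hαβ
    nlinarith
  · refine le_of_mul_le_mul_left ?_ hαβ
    nlinarith

theorem abs_inner_le_sqrt_mul_sqrt {A : E →L[ℝ] E}
    (hA : ∀ u v, ⟪A u, v⟫_ℝ = ⟪A v, u⟫_ℝ) (hpos : ∀ u, u ≠ 0 → 0 < ⟪A u, u⟫_ℝ) (u v : E) :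
    |⟪A u, v⟫_ℝ| ≤ √⟪A u, u⟫_ℝ * √⟪A v, v⟫_ℝ := by
  have h : ∀ u, |⟪A u, u⟫_ℝ| ≤ 1 * ⟪A u, u⟫_ℝ := fun u => by
    rw [one_mul, abs_of_nonneg]
    rcases eq_or_ne u 0 with rfl | hu
    · simp
    · exact (hpos u hu).le
  simpa using abs_inner_le_of_abs_quadratic_le hA hpos hA h u v

/-- A symmetric trilinear form bounded on the diagonal in the norm of a positive definite `A` obeys
the same bound off the diagonal, at triples `(u, v, v)`. -/
theorem abs_trilinear_le {A : E →L[ℝ] E} {T : E →L[ℝ] E →L[ℝ] E}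
    (hA : ∀ u v, ⟪A u, v⟫_ℝ = ⟪A v, u⟫_ℝ) (hpos : ∀ u, u ≠ 0 → 0 < ⟪A u, u⟫_ℝ)
    (hT : ∀ u v w, ⟪T u v, w⟫_ℝ = ⟪T v u, w⟫_ℝ)
    (hT' : ∀ u v w, ⟪T u v, w⟫_ℝ = ⟪T u w, v⟫_ℝ) {c : ℝ}
    (hc : ∀ u, |⟪T u u, u⟫_ℝ| ≤ c * √⟪A u, u⟫_ℝ ^ 3) (u v : E) :
    |⟪T u v, v⟫_ℝ| ≤ c * (√⟪A u, u⟫_ℝ * ⟪A v, v⟫_ℝ) := by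
  rcases eq_or_ne u 0 with rfl | hu
  · simp
  rcases eq_or_ne v 0 with rfl | hv
  · simp
  -- normalised case: unit vectors for the inner product defined by `A`
  have key : ∀ u v, ⟪A u, u⟫_ℝ = 1 → ⟪A v, v⟫_ℝ = 1 → |⟪T u v, v⟫_ℝ| ≤ c := by
    intro u v hu hv
    have hc1 : ∀ e, ⟪A e, e⟫_ℝ = 1 → |⟪T e e, e⟫_ℝ| ≤ c := fun e he => by
      simpa [he] using hc e
    set p := ⟪A u, v⟫_ℝ with hp
    have hr : ⟪A (u - p • v), u - p • v⟫_ℝ = 1 - p ^ 2 := by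
      simp only [map_sub, map_smul, inner_sub_left, inner_sub_right, real_inner_smul_left,
        real_inner_smul_right, hu, hv, hA v u, ← hp]
      ring
    by_cases hz : u - p • v = 0
    · have hup : u = p • v := sub_eq_zero.1 hz
      rw [hz] at hr
      have hp2 : |p| = 1 := by
        have : p ^ 2 = 1 := by simp at hr; linarith
        rcases mul_self_eq_one_iff.1 (by rwa [← sq] : p * p = 1) with h | h <;> simp [h]
      rw [hup, map_smul, smul_apply, real_inner_smul_left, abs_mul, hp2,
        one_mul]
      exact hc1 v hv
    · have hq := hpos _ hz
      rw [hr] at hq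
      have hq' := Real.sqrt_pos.2 hq
      have hq2 := Real.sq_sqrt hq.le
      set q := √(1 - p ^ 2)
      obtain ⟨w, hw⟩ : ∃ w, w = q⁻¹ • (u - p • v) := ⟨_, rfl⟩
      have huw : u = p • v + q • w := by
        rw [hw, smul_smul, mul_inv_cancel₀ hq'.ne', one_smul]; abel
      have hww : ⟪A w, w⟫_ℝ = 1 := by
        rw [hw, map_smul, real_inner_smul_left, real_inner_smul_right, hr, ← hq2]
        field_simp
      have hvw : ⟪A v, w⟫_ℝ = 0 := by
        rw [hw, real_inner_smul_right, inner_sub_right, real_inner_smul_right, hv, hA v u, ← hp]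
        ring
      have := abs_polar_le_of_cubic_le (a := ⟪T v v, v⟫_ℝ) (b := ⟪T w v, v⟫_ℝ)
        (c := ⟪T w w, v⟫_ℝ) (d := ⟪T w w, w⟫_ℝ) (M := c) ?_ (p := p) (q := q) (by linarith)
      · rw [huw]
        simpa [inner_add_left, real_inner_smul_left] using this
      · intro C S hCS
        have h1 := hc1 (C • v + S • w) (by
          simp only [map_add, map_smul, inner_add_left, inner_add_right, real_inner_smul_left,
            real_inner_smul_right, hv, hww, hvw, hA w v]
          linarith)
        convert h1 using 2
        simp only [map_add, map_smul, add_apply,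
          smul_apply, inner_add_left, inner_add_right, real_inner_smul_left,
            real_inner_smul_right, hT v w, hT' w v w, hT' v v w]
        ring
  have hu' := Real.sqrt_pos.2 (hpos u hu)
  have hv' := Real.sqrt_pos.2 (hpos v hv)
  have hu2 := Real.sq_sqrt (hpos u hu).le
  have hv2 := Real.sq_sqrt (hpos v hv).le
  set α := √⟪A u, u⟫_ℝ
  set β := √⟪A v, v⟫_ℝ
  have h := key (α⁻¹ • u) (β⁻¹ • v)
    (by rw [map_smul, real_inner_smul_left, real_inner_smul_right, ← hu2]; field_simp)
    (by rw [map_smul, real_inner_smul_left, real_inner_smul_right, ← hv2]; field_simp)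
  simp only [map_smul, smul_apply, real_inner_smul_left,
    real_inner_smul_right, abs_mul, abs_inv, abs_of_pos hu', abs_of_pos hv'] at h
  rw [← hv2]
  calc |⟪T u v, v⟫_ℝ| = (β⁻¹ * (α⁻¹ * (β⁻¹ * |⟪T u v, v⟫_ℝ|))) * (α * β ^ 2) := by field_simp
    _ ≤ c * (α * β ^ 2) := by
      gcongr
      linarith [h, mul_left_comm α⁻¹ β⁻¹ |⟪T u v, v⟫_ℝ|]

end InnerProduct

variable {n : ℕ} {s : Set (EuclideanSpace ℝ (Fin n))} {F : EuclideanSpace ℝ (Fin n) → ℝ}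
  {x : EuclideanSpace ℝ (Fin n)}

/-! ### Second and third derivatives -/

theorem inner_gradient (x v : EuclideanSpace ℝ (Fin n)) : ⟪∇ F x, v⟫_ℝ = fderiv ℝ F x v := by
  rw [← InnerProductSpace.toDual_apply_apply (𝕜 := ℝ), toDual_gradient]

theorem SelfConcordant.contDiffAt (hF : SelfConcordant s F) (hx : x ∈ s) : ContDiffAt ℝ 3 F x :=
  hF.contDiffOn.contDiffAt (hF.isOpen_dom.mem_nhds hx)

theorem SelfConcordant.contDiffAt_gradient (hF : SelfConcordant s F) (hx : x ∈ s) :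
    ContDiffAt ℝ 2 (∇ F) x := by
  rw [contDiffAt_euclidean]
  intro i
  have h : (fun y => ∇ F y i) = fun y => fderiv ℝ F y (EuclideanSpace.single i 1) := by
    ext y
    rw [← inner_gradient, EuclideanSpace.inner_single_right]
    simp
  rw [h]
  exact ((hF.contDiffAt hx).fderiv_right (m := 2) (by norm_num)).clm_apply contDiffAt_const

theorem SelfConcordant.contDiffAt_hess (hF : SelfConcordant s F) (hx : x ∈ s) :
    ContDiffAt ℝ 1 (hess F) x :=
  (hF.contDiffAt_gradient hx).fderiv_right (m := 1) (by norm_num)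

theorem SelfConcordant.hasFDerivAt_gradient (hF : SelfConcordant s F) (hx : x ∈ s) :
    HasFDerivAt (∇ F) (hess F x) x :=
  ((hF.contDiffAt_gradient hx).differentiableAt (by norm_num)).hasFDerivAt

theorem SelfConcordant.hasFDerivAt_hess (hF : SelfConcordant s F) (hx : x ∈ s) :
    HasFDerivAt (hess F) (fderiv ℝ (hess F) x) x :=
  ((hF.contDiffAt_hess hx).differentiableAt (by norm_num)).hasFDerivAt

theorem SelfConcordant.fderiv_fderiv (hF : SelfConcordant s F) (hx : x ∈ s)
    (u v : EuclideanSpace ℝ (Fin n)) :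
    fderiv ℝ (fderiv ℝ F) x u v = ⟪hess F x u, v⟫_ℝ := by
  have h1 : HasFDerivAt (fderiv ℝ F) (fderiv ℝ (fderiv ℝ F) x) x :=
    (((hF.contDiffAt hx).fderiv_right (m := 2) (by norm_num)).differentiableAt
      (by norm_num)).hasFDerivAt
  have h2 := h1.clm_apply (hasFDerivAt_const v x)
  have h3 := (hF.hasFDerivAt_gradient hx).inner ℝ (hasFDerivAt_const v x)
  simp only [inner_gradient] at h3
  have := congrArg (fun L => L u) (h2.unique h3)
  simpa using this

theorem SelfConcordant.inner_hess_comm (hF : SelfConcordant s F) (hx : x ∈ s)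
    (u v : EuclideanSpace ℝ (Fin n)) : ⟪hess F x u, v⟫_ℝ = ⟪hess F x v, u⟫_ℝ := by
  rw [← hF.fderiv_fderiv hx, ← hF.fderiv_fderiv hx]
  exact (hF.contDiffAt hx).isSymmSndFDerivAt (by simp; norm_num) u v

theorem SelfConcordant.third_swap_left (hF : SelfConcordant s F) (hx : x ∈ s)
    (u v : EuclideanSpace ℝ (Fin n)) :
    fderiv ℝ (hess F) x u v = fderiv ℝ (hess F) x v u :=
  (hF.contDiffAt_gradient hx).isSymmSndFDerivAt (by simp) u v

theorem SelfConcordant.hasFDerivAt_inner_hess (hF : SelfConcordant s F) (hx : x ∈ s)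
    (v w : EuclideanSpace ℝ (Fin n)) :
    HasFDerivAt (fun y => ⟪hess F y v, w⟫_ℝ)
      ((innerSL ℝ w).comp ((fderiv ℝ (hess F) x).flip v)) x := by
  have := ((hF.hasFDerivAt_hess hx).clm_apply (hasFDerivAt_const v x)).inner ℝ
    (hasFDerivAt_const w x)
  exact this.congr_fderiv (by ext u; simp [real_inner_comm])

theorem SelfConcordant.third_swap_right (hF : SelfConcordant s F) (hx : x ∈ s)
    (u v w : EuclideanSpace ℝ (Fin n)) :
    ⟪fderiv ℝ (hess F) x u v, w⟫_ℝ = ⟪fderiv ℝ (hess F) x u w, v⟫_ℝ := by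
  have h1 := hF.hasFDerivAt_inner_hess hx v w
  have h2 := (hF.hasFDerivAt_inner_hess hx w v).congr_of_eventuallyEq
    (f₁ := fun y => ⟪hess F y v, w⟫_ℝ) (by
      filter_upwards [hF.isOpen_dom.mem_nhds hx] with y hy using hF.inner_hess_comm hy v w)
  have : ⟪w, fderiv ℝ (hess F) x u v⟫_ℝ = ⟪v, fderiv ℝ (hess F) x u w⟫_ℝ :=
    congrArg (fun L => L u) (h1.unique h2)
  rwa [real_inner_comm, real_inner_comm _ v] at this

/-- The third derivative of `F` on the diagonal, through the derivative of the Hessian. -/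
theorem SelfConcordant.iteratedFDeriv_three (hF : SelfConcordant s F) (hx : x ∈ s)
    (u : EuclideanSpace ℝ (Fin n)) :
    iteratedFDeriv ℝ 3 F x (fun _ => u) = ⟪fderiv ℝ (hess F) x u u, u⟫_ℝ := by
  have hd : DifferentiableAt ℝ (iteratedFDeriv ℝ 2 F) x :=
    (hF.contDiffAt hx).differentiableAt_iteratedFDeriv (by norm_num)
  have h1 : HasFDerivAt (fun y => iteratedFDeriv ℝ 2 F y (fun _ => u))
      ((ContinuousMultilinearMap.apply ℝ (fun _ : Fin 2 => EuclideanSpace ℝ (Fin n)) ℝ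
        (fun _ => u)).comp (fderiv ℝ (iteratedFDeriv ℝ 2 F) x)) x :=
    (ContinuousMultilinearMap.apply ℝ (fun _ : Fin 2 => EuclideanSpace ℝ (Fin n)) ℝ
        (fun _ => u)).hasFDerivAt.comp x hd.hasFDerivAt
  have h2 := (hF.hasFDerivAt_inner_hess hx u u).congr_of_eventuallyEq
    (f₁ := fun y => iteratedFDeriv ℝ 2 F y (fun _ => u)) (by
      filter_upwards [hF.isOpen_dom.mem_nhds hx] with y hy
      rw [iteratedFDeriv_two_apply, hF.fderiv_fderiv hy])
  rw [iteratedFDeriv_succ_apply_left]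
  have := congrArg (fun L => L u) (h1.unique h2)
  rw [real_inner_comm]
  exact this

theorem hasDerivAt_add_smul (x h : EuclideanSpace ℝ (Fin n)) (t : ℝ) :
    HasDerivAt (fun t : ℝ => x + t • h) h t := by
  simpa using ((hasDerivAt_id t).smul_const h).const_add x

theorem SelfConcordant.hasDerivAt_line (hF : SelfConcordant s F)
    {h : EuclideanSpace ℝ (Fin n)} {t : ℝ} (ht : x + t • h ∈ s) :
    HasDerivAt (fun t : ℝ => F (x + t • h)) ⟪∇ F (x + t • h), h⟫_ℝ t := by
  have h1 : HasFDerivAt F (fderiv ℝ F (x + t • h)) (x + t • h) :=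
    ((hF.contDiffAt ht).differentiableAt (by norm_num)).hasFDerivAt
  rw [inner_gradient]
  exact h1.comp_hasDerivAt t (hasDerivAt_add_smul x h t)

theorem SelfConcordant.hasDerivAt_line_gradient (hF : SelfConcordant s F)
    {h : EuclideanSpace ℝ (Fin n)} (v : EuclideanSpace ℝ (Fin n)) {t : ℝ}
    (ht : x + t • h ∈ s) :
    HasDerivAt (fun t : ℝ => ⟪∇ F (x + t • h), v⟫_ℝ) ⟪hess F (x + t • h) h, v⟫_ℝ t := by
  have := ((hF.hasFDerivAt_gradient ht).comp_hasDerivAt t (hasDerivAt_add_smul x h t)).inner ℝ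
    (hasDerivAt_const t v)
  simpa using this

theorem SelfConcordant.hasDerivAt_line_hess (hF : SelfConcordant s F)
    {h : EuclideanSpace ℝ (Fin n)} (v : EuclideanSpace ℝ (Fin n)) {t : ℝ}
    (ht : x + t • h ∈ s) :
    HasDerivAt (fun t : ℝ => ⟪hess F (x + t • h) v, v⟫_ℝ)
      ⟪fderiv ℝ (hess F) (x + t • h) h v, v⟫_ℝ t := by
  rw [real_inner_comm]
  exact (hF.hasFDerivAt_inner_hess ht v v).comp_hasDerivAt t (hasDerivAt_add_smul x h t)

theorem le_of_hasDerivAt_le {f f' g g' : ℝ → ℝ}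
    (hf : ∀ t ∈ Set.Icc (0 : ℝ) 1, HasDerivAt f (f' t) t)
    (hg : ∀ t ∈ Set.Icc (0 : ℝ) 1, HasDerivAt g (g' t) t)
    (hle : ∀ t ∈ Set.Icc (0 : ℝ) 1, f' t ≤ g' t) (h0 : f 0 ≤ g 0) {t : ℝ}
    (ht : t ∈ Set.Icc (0 : ℝ) 1) : f t ≤ g t :=
  image_le_of_deriv_right_le_deriv_boundary
    (fun t ht => (hf t ht).continuousAt.continuousWithinAt)
    (fun t ht => (hf t (Set.Ico_subset_Icc_self ht)).hasDerivWithinAt) h0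
    (fun t ht => (hg t ht).continuousAt.continuousWithinAt)
    (fun t ht => (hg t (Set.Ico_subset_Icc_self ht)).hasDerivWithinAt)
    (fun t ht => hle t (Set.Ico_subset_Icc_self ht)) ht

theorem SelfConcordant.line_mem (hF : SelfConcordant s F) (hx : x ∈ s)
    {h : EuclideanSpace ℝ (Fin n)} (hxh : x + h ∈ s) {t : ℝ} (ht : t ∈ Set.Icc (0 : ℝ) 1) :
    x + t • h ∈ s :=
  hF.convexOn.1.add_smul_mem hx hxh ht

/-- Upper second-order Taylor bound along a segment. -/
theorem SelfConcordant.le_taylor (hF : SelfConcordant s F) (hx : x ∈ s)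
    {h : EuclideanSpace ℝ (Fin n)} (hxh : x + h ∈ s) {K : ℝ}
    (hK : ∀ t ∈ Set.Icc (0 : ℝ) 1, ⟪hess F (x + t • h) h, h⟫_ℝ ≤ K) :
    F (x + h) ≤ F x + ⟪∇ F x, h⟫_ℝ + K / 2 := by
  have h1 : ∀ t ∈ Set.Icc (0 : ℝ) 1, ⟪∇ F (x + t • h), h⟫_ℝ ≤ ⟪∇ F x, h⟫_ℝ + K * t :=
    fun t ht => le_of_hasDerivAt_le (g := fun t => ⟪∇ F x, h⟫_ℝ + K * t) (g' := fun _ => K)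
      (fun t ht => hF.hasDerivAt_line_gradient h (hF.line_mem hx hxh ht))
      (fun t _ => by simpa using ((hasDerivAt_id t).const_mul K).const_add ⟪∇ F x, h⟫_ℝ)
      hK (by simp) ht
  have h2 := le_of_hasDerivAt_le
      (g := fun t => F x + (⟪∇ F x, h⟫_ℝ * t + K / 2 * t ^ 2))
      (g' := fun t => ⟪∇ F x, h⟫_ℝ + K * t)
      (fun t ht => hF.hasDerivAt_line (hF.line_mem hx hxh ht))
      (fun t _ => by
        refine (((hasDerivAt_id' t).const_mul _).add
          ((hasDerivAt_pow 2 t).const_mul (K / 2))).const_add _ |>.congr_deriv ?_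
        norm_num; ring)
      h1 (by simp) (Set.right_mem_Icc.2 zero_le_one)
  simp only [one_smul] at h2
  linarith

/-- Lower second-order Taylor bound along a segment. -/
theorem SelfConcordant.taylor_le (hF : SelfConcordant s F) (hx : x ∈ s)
    {h : EuclideanSpace ℝ (Fin n)} (hxh : x + h ∈ s) {m : ℝ}
    (hm : ∀ t ∈ Set.Icc (0 : ℝ) 1, m ≤ ⟪hess F (x + t • h) h, h⟫_ℝ) :
    F x + ⟪∇ F x, h⟫_ℝ + m / 2 ≤ F (x + h) := by
  have h1 : ∀ t ∈ Set.Icc (0 : ℝ) 1, ⟪∇ F x, h⟫_ℝ + m * t ≤ ⟪∇ F (x + t • h), h⟫_ℝ :=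
    fun t ht => le_of_hasDerivAt_le (f := fun t => ⟪∇ F x, h⟫_ℝ + m * t) (f' := fun _ => m)
      (fun t _ => by simpa using ((hasDerivAt_id t).const_mul m).const_add ⟪∇ F x, h⟫_ℝ)
      (fun t ht => hF.hasDerivAt_line_gradient h (hF.line_mem hx hxh ht))
      hm (by simp) ht
  have h2 := le_of_hasDerivAt_le
      (f := fun t => F x + (⟪∇ F x, h⟫_ℝ * t + m / 2 * t ^ 2))
      (f' := fun t => ⟪∇ F x, h⟫_ℝ + m * t)
      (fun t _ => by
        refine (((hasDerivAt_id' t).const_mul _).add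
          ((hasDerivAt_pow 2 t).const_mul (m / 2))).const_add _ |>.congr_deriv ?_
        norm_num; ring)
      (fun t ht => hF.hasDerivAt_line (hF.line_mem hx hxh ht))
      h1 (by simp) (Set.right_mem_Icc.2 zero_le_one)
  simp only [one_smul] at h2
  linarith

theorem SelfConcordant.hess_nonneg (hF : SelfConcordant s F) (hx : x ∈ s)
    (u : EuclideanSpace ℝ (Fin n)) : 0 ≤ ⟪hess F x u, u⟫_ℝ := by
  have hopen : IsOpen {t : ℝ | x + t • u ∈ s} :=
    hF.isOpen_dom.preimage (by fun_prop)
  have h0 : (0 : ℝ) ∈ {t : ℝ | x + t • u ∈ s} := by simpa using hx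
  have hconv : ConvexOn ℝ {t : ℝ | x + t • u ∈ s} (fun t : ℝ => F (x + t • u)) := by
    have := hF.convexOn.comp_affineMap (AffineMap.lineMap x (x + u))
    have hl (t : ℝ) : AffineMap.lineMap x (x + u) t = x + t • u := by
      simp [AffineMap.lineMap_apply, add_comm]
    simpa only [Function.comp_def, Set.preimage, hl] using this
  have hmono := hconv.monotoneOn_deriv fun t ht => (hF.hasDerivAt_line ht).differentiableAt
  have hd : HasDerivAt (deriv fun t : ℝ => F (x + t • u)) ⟪hess F (x + (0 : ℝ) • u) u, u⟫_ℝ 0 :=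
    (hF.hasDerivAt_line_gradient u h0).congr_of_eventuallyEq (by
      filter_upwards [hopen.mem_nhds h0] with t ht using (hF.hasDerivAt_line ht).deriv)
  have := hmono.derivWithin_nonneg (x := 0)
  rw [derivWithin_of_isOpen hopen h0, hd.deriv] at this
  simpa using this

/-! ### The local norm and the Dikin ellipsoid -/

/-- The local norm `‖u‖ₓ = (∇²F(x)u, u)^{1/2}`; it is a norm where the Hessian is positive
definite. -/
noncomputable def localNorm (F : EuclideanSpace ℝ (Fin n) → ℝ)
    (x u : EuclideanSpace ℝ (Fin n)) : ℝ :=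
  √⟪hess F x u, u⟫_ℝ

theorem localNorm_nonneg (x u : EuclideanSpace ℝ (Fin n)) : 0 ≤ localNorm F x u :=
  Real.sqrt_nonneg _

theorem SelfConcordant.sq_localNorm (hF : SelfConcordant s F) (hx : x ∈ s)
    (u : EuclideanSpace ℝ (Fin n)) : localNorm F x u ^ 2 = ⟪hess F x u, u⟫_ℝ :=
  Real.sq_sqrt (hF.hess_nonneg hx u)

theorem localNorm_smul (x u : EuclideanSpace ℝ (Fin n)) (t : ℝ) :
    localNorm F x (t • u) = |t| * localNorm F x u := by
  rw [localNorm, localNorm, map_smul, real_inner_smul_left, real_inner_smul_right, ← mul_assoc,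
    Real.sqrt_mul (mul_self_nonneg t), Real.sqrt_mul_self_eq_abs]

theorem localNorm_zero (x : EuclideanSpace ℝ (Fin n)) : localNorm F x 0 = 0 := by
  simp [localNorm]

theorem SelfConcordant.abs_third_diag_le (hF : SelfConcordant s F) (hx : x ∈ s)
    (u : EuclideanSpace ℝ (Fin n)) :
    |⟪fderiv ℝ (hess F) x u u, u⟫_ℝ| ≤ 2 * localNorm F x u ^ 3 := by
  have hr : ⟪hess F x u, u⟫_ℝ ^ (3 / 2 : ℝ) = localNorm F x u ^ 3 := by
    rw [localNorm, Real.sqrt_eq_rpow, ← Real.rpow_natCast, ← Real.rpow_mul (hF.hess_nonneg hx u)]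
    norm_num
  -- The third derivative is odd in `u`, so that the one-sided bound is two-sided.
  have h1 := hF.third_le x hx u
  have h2 := hF.third_le x hx (-u)
  rw [hF.iteratedFDeriv_three hx] at h1 h2
  simp only [map_neg, neg_apply, inner_neg_left, inner_neg_right, neg_neg, hr] at h1 h2
  exact abs_le.2 ⟨by linarith, h1⟩

theorem SelfConcordant.abs_third_le (hF : SelfConcordant s F) (hx : x ∈ s)
    (hP : HessPosDef F x) (u v : EuclideanSpace ℝ (Fin n)) :
    |⟪fderiv ℝ (hess F) x u v, v⟫_ℝ| ≤ 2 * (localNorm F x u * ⟪hess F x v, v⟫_ℝ) :=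
  abs_trilinear_le (hF.inner_hess_comm hx) hP
    (fun u v w => by rw [hF.third_swap_left hx]) (hF.third_swap_right hx)
    (hF.abs_third_diag_le hx) u v

theorem localNorm_pos (hP : HessPosDef F x) {u : EuclideanSpace ℝ (Fin n)}
    (hu : u ≠ 0) : 0 < localNorm F x u := Real.sqrt_pos.2 (hP u hu)

/-- Self-concordance says that `1 / ‖h‖_{x+th}` has derivative at least `-1` in `t`. -/
theorem SelfConcordant.localNorm_line_le (hF : SelfConcordant s F)
    (hP : ∀ x ∈ s, HessPosDef F x) (hx : x ∈ s) {h : EuclideanSpace ℝ (Fin n)} (hxh : x + h ∈ s)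
    (hr : localNorm F x h < 1) {t : ℝ} (ht : t ∈ Set.Icc (0 : ℝ) 1) :
    localNorm F (x + t • h) h ≤ localNorm F x h / (1 - t * localNorm F x h) := by
  rcases eq_or_ne h 0 with rfl | hh
  · simp [localNorm_zero]
  have hmem : ∀ t ∈ Set.Icc (0 : ℝ) 1, x + t • h ∈ s := fun t ht => hF.line_mem hx hxh ht
  have hpos : ∀ t ∈ Set.Icc (0 : ℝ) 1, 0 < localNorm F (x + t • h) h := fun t ht =>
    localNorm_pos (hP _ (hmem t ht)) hh
  have hr0 := localNorm_pos (hP x hx) hh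
  -- Compare `1 / ‖h‖_{x+th}` with the line of slope `-1` through its initial value.
  have key := le_of_hasDerivAt_le (f := fun t => (localNorm F x h)⁻¹ - t) (f' := fun _ => -1)
    (g := fun t => (localNorm F (x + t • h) h)⁻¹)
    (fun t _ => (hasDerivAt_id' t).const_sub _)
    (fun t ht => ((hF.hasDerivAt_line_hess h (hmem t ht)).sqrt
      (hP _ (hmem t ht) h hh).ne').fun_inv (hpos t ht).ne') ?_ (by simp) ht
  · have h1 : 0 < 1 - t * localNorm F x h := by nlinarith [ht.1, ht.2]
    rw [le_div_iff₀ h1]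
    have h2 := hpos t ht
    have h3 := mul_le_mul_of_nonneg_left key (mul_pos h2 hr0).le
    field_simp at h3
    linarith
  · intro t ht
    have h2 := hpos t ht
    have h3 := (abs_le.1 (hF.abs_third_diag_le (hmem t ht) h)).2
    change -1 ≤ -(_ / (2 * localNorm F (x + t • h) h)) / localNorm F (x + t • h) h ^ 2
    rw [neg_div, div_div, neg_le_neg_iff, div_le_one (by positivity)]
    linarith

/-- The Hessians at `x` and `x + th` differ at most by the factor `(1 - t‖h‖ₓ)²`: by the mixed bound
on the third derivative, `(1 - t‖h‖ₓ)² (∇²F(x+th)v, v)` decreases and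
`(1 - t‖h‖ₓ)⁻² (∇²F(x+th)v, v)` increases in `t`. -/
theorem SelfConcordant.hess_line_bounds (hF : SelfConcordant s F)
    (hP : ∀ x ∈ s, HessPosDef F x) (hx : x ∈ s) {h : EuclideanSpace ℝ (Fin n)} (hxh : x + h ∈ s)
    (hr : localNorm F x h < 1) (v : EuclideanSpace ℝ (Fin n)) {t : ℝ}
    (ht : t ∈ Set.Icc (0 : ℝ) 1) :
    (1 - t * localNorm F x h) ^ 2 * ⟪hess F x v, v⟫_ℝ ≤ ⟪hess F (x + t • h) v, v⟫_ℝ ∧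
      (1 - t * localNorm F x h) ^ 2 * ⟪hess F (x + t • h) v, v⟫_ℝ ≤ ⟪hess F x v, v⟫_ℝ := by
  have hmem : ∀ t ∈ Set.Icc (0 : ℝ) 1, x + t • h ∈ s := fun t ht => hF.line_mem hx hxh ht
  have hr0 := localNorm_nonneg (F := F) x h
  have h1 : ∀ t ∈ Set.Icc (0 : ℝ) 1, 0 < 1 - t * localNorm F x h := fun t ht => by
    nlinarith [ht.1, ht.2]
  have hd : ∀ t, HasDerivAt (fun t => 1 - t * localNorm F x h) (-localNorm F x h) t := fun t => by
    simpa using ((hasDerivAt_id' t).mul_const (localNorm F x h)).const_sub 1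
  have hT : ∀ t ∈ Set.Icc (0 : ℝ) 1, |⟪fderiv ℝ (hess F) (x + t • h) h v, v⟫_ℝ| *
      (1 - t * localNorm F x h) ≤ 2 * localNorm F x h * ⟪hess F (x + t • h) v, v⟫_ℝ := by
    intro t ht
    have h3 := hF.abs_third_le (hmem t ht) (hP _ (hmem t ht)) h v
    have h4 := hF.localNorm_line_le hP hx hxh hr ht
    rw [le_div_iff₀ (h1 t ht)] at h4
    have h5 := hF.hess_nonneg (hmem t ht) v
    calc _ ≤ 2 * (localNorm F (x + t • h) h * ⟪hess F (x + t • h) v, v⟫_ℝ) *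
          (1 - t * localNorm F x h) := by gcongr; exact (h1 t ht).le
      _ = 2 * (localNorm F (x + t • h) h * (1 - t * localNorm F x h)) *
          ⟪hess F (x + t • h) v, v⟫_ℝ := by ring
      _ ≤ _ := by gcongr
  constructor
  · have key := le_of_hasDerivAt_le (f := fun _ => ⟪hess F x v, v⟫_ℝ) (f' := fun _ => 0)
      (g := fun t => ⟪hess F (x + t • h) v, v⟫_ℝ / (1 - t * localNorm F x h) ^ 2)
      (fun t _ => hasDerivAt_const t _)
      (fun t ht => (hF.hasDerivAt_line_hess v (hmem t ht)).fun_div ((hd t).fun_pow 2)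
        (pow_ne_zero 2 (h1 t ht).ne')) ?_ (by simp) ht
    · rwa [le_div_iff₀ (pow_pos (h1 t ht) 2), mul_comm] at key
    · intro t ht
      have h2 := h1 t ht
      have h3 := hT t ht
      have h4 := mul_le_mul_of_nonneg_right (neg_abs_le ⟪fderiv ℝ (hess F) (x + t • h) h v, v⟫_ℝ)
        h2.le
      apply div_nonneg _ (by positivity)
      norm_num
      nlinarith
  · have key := le_of_hasDerivAt_le (g := fun _ => ⟪hess F x v, v⟫_ℝ) (g' := fun _ => 0)
      (f := fun t => (1 - t * localNorm F x h) ^ 2 * ⟪hess F (x + t • h) v, v⟫_ℝ)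
      (fun t ht => ((hd t).fun_pow 2).fun_mul (hF.hasDerivAt_line_hess v (hmem t ht)))
      (fun t _ => hasDerivAt_const t _) ?_ (by simp) ht
    · exact key
    · intro t ht
      have h2 := h1 t ht
      have h3 := hT t ht
      have h4 := mul_le_mul_of_nonneg_right (le_abs_self ⟪fderiv ℝ (hess F) (x + t • h) h v, v⟫_ℝ)
        h2.le
      norm_num
      nlinarith

/-- Since the epigraph is closed, a segment starting in the domain leaves it only if `F` becomes
unbounded before. -/
theorem SelfConcordant.add_mem_of_bddAbove (hF : SelfConcordant s F) (hx : x ∈ s)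
    {h : EuclideanSpace ℝ (Fin n)} {B : ℝ}
    (hB : ∀ t ∈ Set.Icc (0 : ℝ) 1, x + t • h ∈ s → F (x + t • h) ≤ B) : x + h ∈ s := by
  have hcont : Continuous fun t : ℝ => x + t • h := by fun_prop
  have key := isPreconnected_Icc.subset_of_closure_inter_subset (s := Set.Icc (0 : ℝ) 1)
    (u := {t : ℝ | x + t • h ∈ s}) (hF.isOpen_dom.preimage hcont)
    ⟨0, Set.left_mem_Icc.2 zero_le_one, by simpa using hx⟩ ?_
  · simpa using key (Set.right_mem_Icc.2 zero_le_one)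
  · rintro t ⟨htc, ht⟩
    have hline : ∀ t ∈ Set.Icc (0 : ℝ) 1, x + t • h ∈ s → (x + t • h, B) ∈
        {p : EuclideanSpace ℝ (Fin n) × ℝ | p.1 ∈ s ∧ F p.1 ≤ p.2} :=
      fun t ht hm => ⟨hm, hB t ht hm⟩
    rcases ht.1.eq_or_lt with rfl | ht0
    · simpa using hx
    by_contra hts
    -- every earlier point of the segment lies in `s`
    have hlt : ∀ τ ∈ Set.Ico 0 t, x + τ • h ∈ s := by
      intro τ hτ
      -- Some `σ > τ` has its point in `s`, and so has `τ` by convexity.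
      obtain ⟨σ, hσ, hτσ⟩ := mem_closure_iff_nhds.1 htc (Set.Ioi τ) (Ioi_mem_nhds hτ.2)
      have hσ0 : 0 < σ := hτ.1.trans_lt hσ
      have := hF.line_mem hx hτσ (t := τ / σ)
        ⟨by have := hτ.1; positivity, (div_le_one hσ0).2 (le_of_lt hσ)⟩
      rwa [smul_smul, div_mul_cancel₀ _ hσ0.ne'] at this
    have htend : Tendsto (fun τ : ℝ => (x + τ • h, B)) (𝓝[<] t) (𝓝 (x + t • h, B)) :=
      ((hcont.prodMk continuous_const).tendsto t).mono_left nhdsWithin_le_nhds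
    have := hF.isClosed_epi.mem_of_tendsto htend (by
      filter_upwards [Ico_mem_nhdsLT ht0] with τ hτ using
        hline τ ⟨hτ.1, hτ.2.le.trans ht.2⟩ (hlt τ hτ))
    exact hts this.1

/-- The open Dikin ellipsoid around a point of the domain lies in the domain. -/
theorem SelfConcordant.add_mem_of_localNorm_lt_one (hF : SelfConcordant s F)
    (hP : ∀ x ∈ s, HessPosDef F x) (hx : x ∈ s) {h : EuclideanSpace ℝ (Fin n)}
    (hr : localNorm F x h < 1) : x + h ∈ s := by
  have hr0 := localNorm_nonneg (F := F) x h
  set r := localNorm F x h with hrdef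
  refine hF.add_mem_of_bddAbove hx (B := F x + |⟪∇ F x, h⟫_ℝ| + (r / (1 - r)) ^ 2 / 2) ?_
  intro t ht hm
  have htr : localNorm F x (t • h) = t * r := by rw [localNorm_smul, abs_of_nonneg ht.1]
  have htr1 : t * r ≤ r := mul_le_of_le_one_left hr0 ht.2
  have h1 := hF.le_taylor hx hm (K := (r / (1 - r)) ^ 2) ?_
  · have h2 : ⟪∇ F x, t • h⟫_ℝ ≤ |⟪∇ F x, h⟫_ℝ| := by
      rw [real_inner_smul_right]
      calc t * ⟪∇ F x, h⟫_ℝ ≤ t * |⟪∇ F x, h⟫_ℝ| := by gcongr; exacts [ht.1, le_abs_self _]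
        _ ≤ _ := mul_le_of_le_one_left (abs_nonneg _) ht.2
    linarith
  · intro τ hτ
    have h2 := hF.localNorm_line_le hP hx hm (by linarith) hτ
    rw [← hF.sq_localNorm (hF.line_mem hx hm hτ)]
    refine pow_le_pow_left₀ (localNorm_nonneg _ _) (h2.trans ?_) 2
    rw [htr]
    have : τ * (t * r) ≤ r := (mul_le_of_le_one_left (mul_nonneg ht.1 hr0) hτ.2).trans htr1
    gcongr

theorem SelfConcordant.hess_bounds (hF : SelfConcordant s F)
    (hP : ∀ x ∈ s, HessPosDef F x) (hx : x ∈ s) {y : EuclideanSpace ℝ (Fin n)}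
    (hr : localNorm F x (y - x) < 1) (v : EuclideanSpace ℝ (Fin n)) :
    (1 - localNorm F x (y - x)) * localNorm F x v ≤ localNorm F y v ∧
      (1 - localNorm F x (y - x)) * localNorm F y v ≤ localNorm F x v := by
  have hy := hF.add_mem_of_localNorm_lt_one hP hx hr
  have h := hF.hess_line_bounds hP hx hy hr v (Set.right_mem_Icc.2 zero_le_one)
  rw [add_sub_cancel] at hy
  rw [one_smul, add_sub_cancel, one_mul, ← hF.sq_localNorm hx, ← hF.sq_localNorm hy, ← mul_pow,
    ← mul_pow] at h
  exact ⟨le_of_pow_le_pow_left₀ two_ne_zero (localNorm_nonneg _ _) h.1,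
    le_of_pow_le_pow_left₀ two_ne_zero (localNorm_nonneg _ _) h.2⟩

/-- A degenerate direction of the Hessian stays degenerate along the line it spans: the function
`g(t) = (∇²F(x+tu)u, u)` obeys `|g'| ≤ 2 g^{3/2} ≤ K g`, so that it vanishes with `g(0)`. -/
theorem SelfConcordant.hess_line_eq_zero (hF : SelfConcordant s F) (hx : x ∈ s)
    {u : EuclideanSpace ℝ (Fin n)} (hxu : x + u ∈ s) (h0 : ⟪hess F x u, u⟫_ℝ = 0)
    {t : ℝ} (ht : t ∈ Set.Icc (0 : ℝ) 1) : ⟪hess F (x + t • u) u, u⟫_ℝ = 0 := by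
  have hmem : ∀ t ∈ Set.Icc (0 : ℝ) 1, x + t • u ∈ s := fun t ht => hF.line_mem hx hxu ht
  have hc : ContinuousOn (fun t : ℝ => ⟪hess F (x + t • u) u, u⟫_ℝ) (Set.Icc 0 1) := fun t ht =>
    (hF.hasDerivAt_line_hess u (hmem t ht)).continuousAt.continuousWithinAt
  obtain ⟨K, hK⟩ := isCompact_Icc.bddAbove_image (f := fun t : ℝ => localNorm F (x + t • u) u)
    (Real.continuous_sqrt.comp_continuousOn hc)
  refine eq_zero_of_abs_deriv_le_mul_abs_self_of_eq_zero_right (K := 2 * K) hc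
    (fun t ht => (hF.hasDerivAt_line_hess u
      (hmem t (Set.Ico_subset_Icc_self ht))).hasDerivWithinAt) (by simpa using h0) ?_ t ht
  intro t ht
  have ht := Set.Ico_subset_Icc_self ht
  have h1 := hF.abs_third_diag_le (hmem t ht) u
  have h2 : localNorm F (x + t • u) u ≤ K := hK ⟨t, ht, rfl⟩
  rw [Real.norm_eq_abs, Real.norm_eq_abs, abs_of_nonneg (hF.hess_nonneg (hmem t ht) u),
    ← hF.sq_localNorm (hmem t ht)]
  nlinarith [mul_le_mul_of_nonneg_right h2 (sq_nonneg (localNorm F (x + t • u) u))]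

theorem SelfConcordant.add_mem_of_hess_eq_zero (hF : SelfConcordant s F) (hx : x ∈ s)
    {u : EuclideanSpace ℝ (Fin n)} (h0 : ⟪hess F x u, u⟫_ℝ = 0) : x + u ∈ s := by
  refine hF.add_mem_of_bddAbove hx (B := F x + |⟪∇ F x, u⟫_ℝ|) ?_
  intro t ht hm
  have h1 := hF.le_taylor hx hm (K := 0) fun τ hτ =>
    (hF.hess_line_eq_zero hx hm (by
      rw [map_smul, real_inner_smul_left, real_inner_smul_right, h0]; simp) hτ).le
  have h2 : ⟪∇ F x, t • u⟫_ℝ ≤ |⟪∇ F x, u⟫_ℝ| := by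
    rw [real_inner_smul_right]
    calc t * ⟪∇ F x, u⟫_ℝ ≤ t * |⟪∇ F x, u⟫_ℝ| := by gcongr; exacts [ht.1, le_abs_self _]
      _ ≤ _ := mul_le_of_le_one_left (abs_nonneg _) ht.2
  linarith

theorem SelfConcordant.hessPosDef_of_containsNoLine (hF : SelfConcordant s F)
    (hs : ContainsNoLine s) (hx : x ∈ s) : HessPosDef F x := by
  intro u hu
  refine (hF.hess_nonneg hx u).lt_of_ne fun h0 => hs ⟨x, u, hu, fun t => ?_⟩
  exact hF.add_mem_of_hess_eq_zero hx (by
    rw [map_smul, real_inner_smul_left, real_inner_smul_right, ← h0]; simp)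

/-! ### The Newton step -/

theorem HessPosDef.hess_inverse_apply (hP : HessPosDef F x) (g : EuclideanSpace ℝ (Fin n)) :
    hess F x ((hess F x).inverse g) = g := by
  have hinj : Function.Injective (hess F x).toLinearMap := by
    refine (injective_iff_map_eq_zero _).2 fun u hu => ?_
    by_contra hne
    have := hP u hne
    rw [show hess F x u = 0 from hu, inner_zero_left] at this
    exact this.false
  let e := (LinearEquiv.ofInjectiveEndo _ hinj).toContinuousLinearEquiv
  have he : (e : EuclideanSpace ℝ (Fin n) →L[ℝ] EuclideanSpace ℝ (Fin n)) = hess F x := by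
    ext1 u; rfl
  rw [← he, ContinuousLinearMap.inverse_equiv]
  exact e.apply_symm_apply g

theorem HessPosDef.newtonDecrement_eq (hP : HessPosDef F x) :
    newtonDecrement F x = localNorm F x ((hess F x).inverse (∇ F x)) := by
  rw [newtonDecrement, localNorm, hP.hess_inverse_apply, real_inner_comm]

theorem newtonDecrement_nonneg (x : EuclideanSpace ℝ (Fin n)) : 0 ≤ newtonDecrement F x :=
  Real.sqrt_nonneg _

theorem SelfConcordant.abs_inner_hess_le (hF : SelfConcordant s F) (hx : x ∈ s)
    (hP : HessPosDef F x) (u v : EuclideanSpace ℝ (Fin n)) :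
    |⟪hess F x u, v⟫_ℝ| ≤ localNorm F x u * localNorm F x v :=
  abs_inner_le_sqrt_mul_sqrt (hF.inner_hess_comm hx) hP u v

/-- The Newton decrement bounds the dual local norm of the gradient. -/
theorem SelfConcordant.abs_inner_gradient_le (hF : SelfConcordant s F) (hx : x ∈ s)
    (hP : HessPosDef F x) (v : EuclideanSpace ℝ (Fin n)) :
    |⟪∇ F x, v⟫_ℝ| ≤ newtonDecrement F x * localNorm F x v := by
  have := hF.abs_inner_hess_le hx hP ((hess F x).inverse (∇ F x)) v
  rwa [hP.hess_inverse_apply, ← hP.newtonDecrement_eq] at this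

/-- The Newton decrement is the least constant bounding the gradient in the local norm. -/
theorem SelfConcordant.newtonDecrement_le (hF : SelfConcordant s F) (hx : x ∈ s)
    (hP : HessPosDef F x) {c : ℝ} (hc0 : 0 ≤ c)
    (hc : ∀ v, ⟪∇ F x, v⟫_ℝ ≤ c * localNorm F x v) : newtonDecrement F x ≤ c := by
  have h1 := hc ((hess F x).inverse (∇ F x))
  have h2 := hF.sq_localNorm hx ((hess F x).inverse (∇ F x))
  rw [hP.hess_inverse_apply] at h2
  rw [← h2, ← hP.newtonDecrement_eq] at h1
  rcases (newtonDecrement_nonneg (F := F) x).eq_or_lt with h0 | h0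
  · rwa [← h0]
  · rw [sq] at h1
    exact le_of_mul_le_mul_right h1 h0

theorem SelfConcordant.localNorm_add_le (hF : SelfConcordant s F) (hx : x ∈ s)
    (hP : HessPosDef F x) (u v : EuclideanSpace ℝ (Fin n)) :
    localNorm F x (u + v) ≤ localNorm F x u + localNorm F x v := by
  refine le_of_pow_le_pow_left₀ two_ne_zero
    (add_nonneg (localNorm_nonneg _ _) (localNorm_nonneg _ _)) ?_
  have h := (abs_le.1 (hF.abs_inner_hess_le hx hP u v)).2
  rw [add_sq, hF.sq_localNorm hx, hF.sq_localNorm hx, hF.sq_localNorm hx, map_add,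
    inner_add_left, inner_add_right, inner_add_right, hF.inner_hess_comm hx v u]
  linarith

theorem SelfConcordant.exists_norm_le_localNorm (hF : SelfConcordant s F) (hx : x ∈ s)
    (hP : HessPosDef F x) : ∃ c, 0 ≤ c ∧ ∀ u, ‖u‖ ≤ c * localNorm F x u := by
  refine ⟨√‖(hess F x).inverse‖, Real.sqrt_nonneg _, fun u => ?_⟩
  rcases eq_or_ne u 0 with rfl | hu
  · simp [localNorm_zero]
  have hu' := norm_pos_iff.2 hu
  have h1 := hF.abs_inner_hess_le hx hP ((hess F x).inverse u) u
  rw [hP.hess_inverse_apply, real_inner_self_eq_norm_sq, abs_of_nonneg (sq_nonneg _)] at h1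
  have h2 : localNorm F x ((hess F x).inverse u) ≤ √‖(hess F x).inverse‖ * ‖u‖ := by
    rw [localNorm, hP.hess_inverse_apply, ← Real.sqrt_sq hu'.le,
      ← Real.sqrt_mul (norm_nonneg _)]
    refine Real.sqrt_le_sqrt ?_
    rw [sq, ← mul_assoc]
    exact (real_inner_le_norm _ _).trans (by
      rw [mul_comm]; gcongr; exact ContinuousLinearMap.le_opNorm _ _)
  have h3 := h1.trans (mul_le_mul_of_nonneg_right h2 (localNorm_nonneg _ _))
  refine le_of_mul_le_mul_left ?_ hu'
  linarith

theorem localNorm_le_norm (F : EuclideanSpace ℝ (Fin n) → ℝ) (x u : EuclideanSpace ℝ (Fin n)) :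
    localNorm F x u ≤ √‖hess F x‖ * ‖u‖ := by
  rw [localNorm, ← Real.sqrt_sq (norm_nonneg u), ← Real.sqrt_mul (norm_nonneg _)]
  refine Real.sqrt_le_sqrt ?_
  rw [sq, ← mul_assoc]
  exact (real_inner_le_norm _ _).trans (by
    gcongr; exact ContinuousLinearMap.le_opNorm _ _)

theorem continuous_localNorm (F : EuclideanSpace ℝ (Fin n) → ℝ)
    (x : EuclideanSpace ℝ (Fin n)) : Continuous (localNorm F x) :=
  Real.continuous_sqrt.comp (((hess F x).continuous).inner continuous_id)

theorem SelfConcordant.continuousAt_localNorm (hF : SelfConcordant s F) (hx : x ∈ s)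
    (u : EuclideanSpace ℝ (Fin n)) : ContinuousAt (fun y => localNorm F y u) x :=
  (hF.hasFDerivAt_inner_hess hx u u).continuousAt.sqrt

theorem HessPosDef.localNorm_newtonStep_sub (hP : HessPosDef F x) :
    localNorm F x (newtonStep F x - x) = newtonDecrement F x := by
  rw [newtonStep, sub_sub_cancel_left, ← neg_one_smul ℝ, localNorm_smul, hP.newtonDecrement_eq]
  simp

theorem SelfConcordant.newtonStep_mem (hF : SelfConcordant s F)
    (hP : ∀ x ∈ s, HessPosDef F x) (hx : x ∈ s) (hl : newtonDecrement F x < 1) :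
    newtonStep F x ∈ s := by
  have := hF.add_mem_of_localNorm_lt_one hP hx (h := newtonStep F x - x)
    (by rwa [(hP x hx).localNorm_newtonStep_sub])
  rwa [add_sub_cancel] at this

/-- The gradient after a Newton step, measured in the local norm at the starting point. -/
theorem SelfConcordant.inner_gradient_newtonStep_le (hF : SelfConcordant s F)
    (hP : ∀ x ∈ s, HessPosDef F x) (hx : x ∈ s) (hl : newtonDecrement F x < 1)
    (v : EuclideanSpace ℝ (Fin n)) :
    ⟪∇ F (newtonStep F x), v⟫_ℝ ≤
      newtonDecrement F x ^ 2 / (1 - newtonDecrement F x) * localNorm F x v := by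
  obtain ⟨h, hh⟩ : ∃ h, h = newtonStep F x - x := ⟨_, rfl⟩
  have hxh : x + h = newtonStep F x := by rw [hh, add_sub_cancel]
  have hr : localNorm F x h = newtonDecrement F x := by
    rw [hh, (hP x hx).localNorm_newtonStep_sub]
  have hHh : hess F x h = -∇ F x := by
    rw [hh, newtonStep, sub_sub_cancel_left, map_neg, (hP x hx).hess_inverse_apply]
  have hxhs : x + h ∈ s := hxh ▸ hF.newtonStep_mem hP hx hl
  have hmem : ∀ t ∈ Set.Icc (0 : ℝ) 1, x + t • h ∈ s := fun t ht => hF.line_mem hx hxhs ht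
  rw [← hxh]
  have hr0 := newtonDecrement_nonneg (F := F) x
  set r := newtonDecrement F x with hrdef
  have h1 : ∀ t ∈ Set.Icc (0 : ℝ) 1, 0 < 1 - t * r := fun t ht => by nlinarith [ht.1, ht.2]
  have hd : ∀ t, HasDerivAt (fun t => 1 - t * r) (-r) t := fun t => by
    simpa using ((hasDerivAt_id' t).mul_const r).const_sub 1
  -- The left-hand function has derivative `((∇²F(x+th) - ∇²F(x))h, v)`, as `∇²F(x)h = -∇F(x)`; the
  -- right-hand one is `‖v‖ₓ ∫₀ᵗ ((1 - τr)⁻² - 1) r dτ`.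
  have key := le_of_hasDerivAt_le
    (f := fun t => ⟪∇ F (x + t • h), v⟫_ℝ - (1 - t) * ⟪∇ F x, v⟫_ℝ)
    (g := fun t => ((1 - t * r)⁻¹ + (1 - t * r)) * localNorm F x v - 2 * localNorm F x v)
    (fun t ht => (hF.hasDerivAt_line_gradient v (hmem t ht)).fun_sub
      (((hasDerivAt_id' t).const_sub 1).mul_const _))
    (fun t ht => ((((hd t).fun_inv (h1 t ht).ne').fun_add (hd t)).mul_const
      (localNorm F x v)).sub_const _) ?_ (by norm_num) (Set.right_mem_Icc.2 zero_le_one)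
  · have h2 : 0 < 1 - r := by linarith
    simp only [one_smul, one_mul, sub_self, zero_mul, sub_zero] at key
    refine key.trans_eq ?_
    field_simp
    ring
  · intro t ht
    have h2 := h1 t ht
    set q := 1 - t * r with hq
    have h3 := abs_inner_le_of_abs_quadratic_le (A := hess F x)
      (G := hess F (x + t • h) - hess F x) (c := (q ^ 2)⁻¹ - 1) (hF.inner_hess_comm hx) (hP x hx)
      (fun u w => by
        rw [sub_apply, sub_apply, inner_sub_left, inner_sub_left, hF.inner_hess_comm hx u w,
          hF.inner_hess_comm (hmem t ht) u w]) ?_ h v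
    · have h4 : _ ≤ ((q ^ 2)⁻¹ - 1) * (localNorm F x h * localNorm F x v) := (abs_le.1 h3).2
      rw [hr, sub_apply, inner_sub_left, hHh, inner_neg_left] at h4
      calc _ = ⟪hess F (x + t • h) h, v⟫_ℝ - -⟪∇ F x, v⟫_ℝ := by ring
        _ ≤ _ := h4
        _ = _ := by rw [neg_neg, div_eq_mul_inv]; ring
    · intro u
      obtain ⟨h5, h6⟩ := hF.hess_line_bounds hP hx hxhs (hr.trans_lt hl) u ht
      rw [hr, ← hq] at h5 h6
      have h7 := hF.hess_nonneg hx u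
      rw [sub_apply, inner_sub_left]
      set a := ⟪hess F x u, u⟫_ℝ
      set b := ⟪hess F (x + t • h) u, u⟫_ℝ
      have hq2 : 0 < q ^ 2 := by positivity
      have h8 : b ≤ (q ^ 2)⁻¹ * a := by
        rw [inv_mul_eq_div, le_div_iff₀ hq2]; linarith
      have h9 : 2 ≤ q ^ 2 + (q ^ 2)⁻¹ := by
        have : q ^ 2 * (q ^ 2)⁻¹ = 1 := mul_inv_cancel₀ hq2.ne'
        nlinarith [sq_nonneg (q ^ 2 - (q ^ 2)⁻¹), inv_pos.2 hq2]
      rw [abs_le]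
      constructor
      · nlinarith
      · linarith

theorem SelfConcordant.newtonDecrement_newtonStep_le (hF : SelfConcordant s F)
    (hP : ∀ x ∈ s, HessPosDef F x) (hx : x ∈ s) (hl : newtonDecrement F x < 1) :
    newtonDecrement F (newtonStep F x) ≤
      (newtonDecrement F x / (1 - newtonDecrement F x)) ^ 2 := by
  have hy := hF.newtonStep_mem hP hx hl
  refine hF.newtonDecrement_le hy (hP _ hy) (sq_nonneg _) fun v => ?_
  have hr := (hP x hx).localNorm_newtonStep_sub
  have h1 := (hF.hess_bounds hP hx (hr.trans_lt hl) v).1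
  have h2 := hF.inner_gradient_newtonStep_le hP hx hl v
  rw [hr] at h1
  have h3 : 0 < 1 - newtonDecrement F x := by linarith
  have h4 : localNorm F x v ≤ localNorm F (newtonStep F x) v / (1 - newtonDecrement F x) := by
    rw [le_div_iff₀ h3]; linarith
  refine h2.trans ((mul_le_mul_of_nonneg_left h4 (by positivity)).trans_eq ?_)
  field_simp

/-! ### Convergence of the Newton iterates -/

theorem newton_threshold_lt : (3 - √5) / 2 < 1 / 2 := by
  have : 2 < √5 := Real.lt_sqrt_of_sq_lt (by norm_num)
  linarith

theorem lt_one_sub_sq_of_lt_threshold {a : ℝ} (ha : a < (3 - √5) / 2) : a < (1 - a) ^ 2 := by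
  -- The threshold is the smaller root of `(1 - a)² = a`.
  have h5 : √5 ^ 2 = 5 := Real.sq_sqrt (by norm_num)
  have h0 : 0 ≤ √5 := Real.sqrt_nonneg 5
  nlinarith

theorem SelfConcordant.isMinOn_of_gradient_eq_zero (hF : SelfConcordant s F) (hx : x ∈ s)
    (h0 : ∇ F x = 0) : IsMinOn F s x := by
  intro y hy
  have := hF.taylor_le hx (h := y - x) (m := 0) (by rwa [add_sub_cancel])
    fun t ht => hF.hess_nonneg (hF.line_mem hx (by rwa [add_sub_cancel]) ht) _
  rw [add_sub_cancel, h0, inner_zero_left] at this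
  simpa using this

/-- A critical point is the only minimizer: by compactness the second derivative is bounded away
from zero along the segment to any other point. -/
theorem SelfConcordant.eq_of_gradient_eq_zero (hF : SelfConcordant s F)
    (hP : ∀ x ∈ s, HessPosDef F x) (hx : x ∈ s) (h0 : ∇ F x = 0) {y : EuclideanSpace ℝ (Fin n)}
    (hy : y ∈ s) (hxy : F y ≤ F x) : y = x := by
  by_contra hne
  have hy' : x + (y - x) ∈ s := by rwa [add_sub_cancel]
  have hmem : ∀ t ∈ Set.Icc (0 : ℝ) 1, x + t • (y - x) ∈ s := fun t ht => hF.line_mem hx hy' ht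
  obtain ⟨τ, hτ, hmin⟩ := isCompact_Icc.exists_isMinOn (s := Set.Icc (0 : ℝ) 1)
    (f := fun t : ℝ => ⟪hess F (x + t • (y - x)) (y - x), y - x⟫_ℝ)
    (Set.nonempty_Icc.2 zero_le_one)
    (fun t ht => (hF.hasDerivAt_line_hess _ (hmem t ht)).continuousAt.continuousWithinAt)
  have h1 := hF.taylor_le hx hy' fun t ht => hmin ht
  have h2 := hP _ (hmem τ hτ) (y - x) (sub_ne_zero.2 hne)
  rw [add_sub_cancel, h0, inner_zero_left] at h1
  linarith

theorem newtonStep_eq_self (h0 : ∇ F x = 0) : newtonStep F x = x := by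
  rw [newtonStep, h0, map_zero, sub_zero]

theorem SelfConcordant.localNorm_half_bounds (hF : SelfConcordant s F)
    (hP : ∀ x ∈ s, HessPosDef F x) (hx : x ∈ s) {y : EuclideanSpace ℝ (Fin n)}
    (hr : localNorm F x (y - x) ≤ 1 / 2) (v : EuclideanSpace ℝ (Fin n)) :
    localNorm F x v ≤ 2 * localNorm F y v ∧ localNorm F y v ≤ 2 * localNorm F x v := by
  obtain ⟨h1, h2⟩ := hF.hess_bounds hP hx (hr.trans_lt (by norm_num)) v
  have h3 := localNorm_nonneg (F := F) x v
  have h4 := localNorm_nonneg (F := F) y v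
  constructor <;> nlinarith

/-- Near a critical point, the value gap, the squared local distance and the squared Newton
decrement are comparable. -/
theorem SelfConcordant.local_estimates (hF : SelfConcordant s F)
    (hP : ∀ x ∈ s, HessPosDef F x) {xs : EuclideanSpace ℝ (Fin n)} (hxs : xs ∈ s)
    (h0 : ∇ F xs = 0) (hx : x ∈ s) (hr : localNorm F xs (x - xs) ≤ 1 / 2) :
    F x - F xs ≤ 2 * localNorm F xs (x - xs) ^ 2 ∧
      localNorm F xs (x - xs) ^ 2 ≤ 8 * (F x - F xs) ∧
      newtonDecrement F x ≤ 8 * localNorm F xs (x - xs) ∧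
      localNorm F xs (x - xs) ≤ 8 * newtonDecrement F x := by
  obtain ⟨h, hh⟩ : ∃ h, h = x - xs := ⟨_, rfl⟩
  have hxh : xs + h = x := by rw [hh, add_sub_cancel]
  rw [← hh] at hr ⊢
  have hxhs : xs + h ∈ s := hxh ▸ hx
  have hmem : ∀ t ∈ Set.Icc (0 : ℝ) 1, xs + t • h ∈ s := fun t ht => hF.line_mem hxs hxhs ht
  have hr0 := localNorm_nonneg (F := F) xs h
  have hb : ∀ t ∈ Set.Icc (0 : ℝ) 1, ∀ v, localNorm F xs v ≤ 2 * localNorm F (xs + t • h) v ∧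
      localNorm F (xs + t • h) v ≤ 2 * localNorm F xs v := fun t ht =>
    hF.localNorm_half_bounds hP hxs (by
      rw [add_sub_cancel_left, localNorm_smul, abs_of_nonneg ht.1]
      exact (mul_le_of_le_one_left hr0 ht.2).trans hr)
  have hup : ∀ t ∈ Set.Icc (0 : ℝ) 1,
      ⟪hess F (xs + t • h) h, h⟫_ℝ ≤ 4 * localNorm F xs h ^ 2 := fun t ht => by
    rw [← hF.sq_localNorm (hmem t ht)]
    have := (hb t ht h).2
    nlinarith [localNorm_nonneg (F := F) (xs + t • h) h]
  have hlow : ∀ t ∈ Set.Icc (0 : ℝ) 1,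
      localNorm F xs h ^ 2 / 4 ≤ ⟪hess F (xs + t • h) h, h⟫_ℝ := fun t ht => by
    rw [← hF.sq_localNorm (hmem t ht)]
    have := (hb t ht h).1
    nlinarith [localNorm_nonneg (F := F) (xs + t • h) h]
  have h1 := hF.le_taylor hxs hxhs hup
  have h2 := hF.taylor_le hxs hxhs hlow
  rw [h0, inner_zero_left, hxh] at h1 h2
  have hone : (1 : ℝ) ∈ Set.Icc (0 : ℝ) 1 := Set.right_mem_Icc.2 zero_le_one
  have hb1 := hb 1 hone
  rw [one_smul, hxh] at hb1
  refine ⟨by linarith, by linarith, ?_, ?_⟩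
  · refine hF.newtonDecrement_le hx (hP x hx) (by positivity) fun v => ?_
    have key := le_of_hasDerivAt_le (f := fun t => ⟪∇ F (xs + t • h), v⟫_ℝ)
      (g := fun t => t * (4 * (localNorm F xs h * localNorm F xs v)))
      (fun t ht => hF.hasDerivAt_line_gradient v (hmem t ht))
      (fun t _ => (hasDerivAt_id' t).mul_const _) ?_ (by simp [h0]) hone
    · simp only [one_smul, one_mul, hxh] at key
      nlinarith [(hb1 v).1]
    · intro t ht
      have h3 := (abs_le.1 (hF.abs_inner_hess_le (hmem t ht) (hP _ (hmem t ht)) h v)).2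
      have h4 := mul_le_mul (hb t ht h).2 (hb t ht v).2 (localNorm_nonneg _ _) (by positivity)
      linarith
  · have key := le_of_hasDerivAt_le (f := fun t => t * (localNorm F xs h ^ 2 / 4))
      (g := fun t => ⟪∇ F (xs + t • h), h⟫_ℝ)
      (fun t _ => (hasDerivAt_id' t).mul_const _)
      (fun t ht => hF.hasDerivAt_line_gradient h (hmem t ht))
      (by simpa using hlow) (by simp [h0]) hone
    simp only [one_smul, one_mul, hxh] at key
    have h3 := (abs_le.1 (hF.abs_inner_gradient_le hx (hP x hx) h)).2
    have h4 := mul_le_mul_of_nonneg_left (hb1 h).2 (newtonDecrement_nonneg (F := F) x)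
    rcases hr0.eq_or_lt with h5 | h5
    · rw [← h5]
      exact mul_nonneg (by norm_num) (newtonDecrement_nonneg _)
    · refine le_of_mul_le_mul_right ?_ h5
      linarith

/-- A bound that holds eventually holds for all indices with a larger constant. -/
theorem exists_const_of_eventually_le_mul {a b : ℕ → ℝ} {C : ℝ} (hb : ∀ k, 0 ≤ b k)
    (hab : ∀ k, b k = 0 → a k ≤ 0) (h : ∀ᶠ k in atTop, a k ≤ C * b k) :
    ∃ C', ∀ k, a k ≤ C' * b k := by
  obtain ⟨K, hK⟩ := eventually_atTop.1 h
  have hs : 0 ≤ ∑ j ∈ Finset.range K, |a j| / b j :=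
    Finset.sum_nonneg fun j _ => div_nonneg (abs_nonneg _) (hb j)
  refine ⟨|C| + ∑ j ∈ Finset.range K, |a j| / b j, fun k => ?_⟩
  rcases (hb k).eq_or_lt with h0 | h0
  · rw [← h0, mul_zero]
    exact hab k h0.symm
  rcases lt_or_ge k K with hk | hk
  · have h1 : |a k| / b k ≤ ∑ j ∈ Finset.range K, |a j| / b j :=
      Finset.single_le_sum (f := fun j => |a j| / b j)
        (fun j _ => div_nonneg (abs_nonneg _) (hb j)) (Finset.mem_range.2 hk)
    rw [div_le_iff₀ h0] at h1
    nlinarith [le_abs_self (a k), abs_nonneg C]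
  · have h1 := hK k hk
    nlinarith [le_abs_self C]

theorem SelfConcordant.newton_iterates_decrement (hF : SelfConcordant s F)
    (hP : ∀ x ∈ s, HessPosDef F x) {x : ℕ → EuclideanSpace ℝ (Fin n)} (h0 : x 0 ∈ s)
    (hl : newtonDecrement F (x 0) < (3 - √5) / 2) (hx : ∀ k, x (k + 1) = newtonStep F (x k))
    (k : ℕ) : x k ∈ s ∧ newtonDecrement F (x k) ≤ newtonDecrement F (x 0) ∧
      newtonDecrement F (x (k + 1)) ≤
        (newtonDecrement F (x k) / (1 - newtonDecrement F (x k))) ^ 2 ∧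
      newtonDecrement F (x (k + 1)) ≤
        newtonDecrement F (x k) ^ 2 / (1 - newtonDecrement F (x 0)) ^ 2 := by
  have ht := newton_threshold_lt
  have hq := lt_one_sub_sq_of_lt_threshold hl
  have main : ∀ k, x k ∈ s → newtonDecrement F (x k) ≤ newtonDecrement F (x 0) →
      newtonDecrement F (x (k + 1)) ≤
        (newtonDecrement F (x k) / (1 - newtonDecrement F (x k))) ^ 2 ∧
      newtonDecrement F (x (k + 1)) ≤
        newtonDecrement F (x k) ^ 2 / (1 - newtonDecrement F (x 0)) ^ 2 := by
    intro k hk hle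
    have h1 : newtonDecrement F (x (k + 1)) ≤ _ :=
      hx k ▸ hF.newtonDecrement_newtonStep_le hP hk (by linarith)
    refine ⟨h1, h1.trans ?_⟩
    rw [div_pow]
    have : 0 < 1 - newtonDecrement F (x 0) := by linarith
    gcongr
  have ind : x k ∈ s ∧ newtonDecrement F (x k) ≤ newtonDecrement F (x 0) := by
    induction k with
    | zero => exact ⟨h0, le_rfl⟩
    | succ k ih =>
      refine ⟨hx k ▸ hF.newtonStep_mem hP ih.1 (by linarith), (main k ih.1 ih.2).2.trans ?_⟩
      have h1 := newtonDecrement_nonneg (F := F) (x k)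
      have h2 : 0 < 1 - newtonDecrement F (x 0) := by linarith
      rw [div_le_iff₀ (by positivity)]
      nlinarith
  exact ⟨ind.1, ind.2, main k ind.1 ind.2⟩

theorem SelfConcordant.tendsto_newtonDecrement (hF : SelfConcordant s F)
    (hP : ∀ x ∈ s, HessPosDef F x) {x : ℕ → EuclideanSpace ℝ (Fin n)} (h0 : x 0 ∈ s)
    (hl : newtonDecrement F (x 0) < (3 - √5) / 2) (hx : ∀ k, x (k + 1) = newtonStep F (x k)) :
    Tendsto (fun k => newtonDecrement F (x k)) atTop (𝓝 0) := by
  have hq := lt_one_sub_sq_of_lt_threshold hl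
  have hq0 := newtonDecrement_nonneg (F := F) (x 0)
  have hq1 : 0 < (1 - newtonDecrement F (x 0)) ^ 2 := hq0.trans_lt hq
  set q := newtonDecrement F (x 0) / (1 - newtonDecrement F (x 0)) ^ 2 with hqdef
  have hb : ∀ k, newtonDecrement F (x k) ≤ newtonDecrement F (x 0) * q ^ k := by
    intro k
    induction k with
    | zero => simp
    | succ k ih =>
      obtain ⟨-, h1, -, h2⟩ := hF.newton_iterates_decrement hP h0 hl hx k
      have h3 := newtonDecrement_nonneg (F := F) (x k)
      calc _ ≤ _ := h2
        _ ≤ newtonDecrement F (x k) * q := by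
          rw [hqdef, mul_div_assoc', sq]; gcongr
        _ ≤ newtonDecrement F (x 0) * q ^ k * q := by gcongr
        _ = _ := by ring
  refine squeeze_zero (fun k => newtonDecrement_nonneg _) hb ?_
  simpa using (tendsto_pow_atTop_nhds_zero_of_lt_one (by positivity)
    ((div_lt_one hq1).2 hq)).const_mul (newtonDecrement F (x 0))

/-- Newton iterates with a small initial decrement never leave the half-radius Dikin ellipsoid of
`x 0`, in which the local norms are comparable; as their steps decrease geometrically, they
converge to a point of the domain. -/
theorem SelfConcordant.exists_tendsto_newton (hF : SelfConcordant s F)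
    (hP : ∀ x ∈ s, HessPosDef F x) {x : ℕ → EuclideanSpace ℝ (Fin n)} (hxs : ∀ k, x k ∈ s)
    (hl : newtonDecrement F (x 0) ≤ 1 / 8) (hx : ∀ k, x (k + 1) = newtonStep F (x k)) :
    ∃ y ∈ s, Tendsto x atTop (𝓝 y) := by
  have hdec : ∀ k, newtonDecrement F (x k) ≤ 1 / 8 * (1 / 2) ^ k := by
    intro k
    induction k with
    | zero => simpa using hl
    | succ k ih =>
      have h1 : newtonDecrement F (x k) ≤ 1 / 8 :=
        ih.trans (mul_le_of_le_one_right (by norm_num) (pow_le_one₀ (by norm_num) (by norm_num)))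
      have h2 := hF.newtonDecrement_newtonStep_le hP (hxs k) (by linarith)
      have h3 := newtonDecrement_nonneg (F := F) (x k)
      rw [← hx k, div_pow] at h2
      have h4 : newtonDecrement F (x k) ^ 2 / (1 - newtonDecrement F (x k)) ^ 2 ≤
          newtonDecrement F (x k) * (1 / 2) := by
        rw [div_le_iff₀ (by nlinarith)]
        have : newtonDecrement F (x k) ≤ 1 / 2 * (1 - newtonDecrement F (x k)) ^ 2 := by nlinarith
        nlinarith
      rw [pow_succ]
      linarith
  have hstep : ∀ k, localNorm F (x 0) (x k - x 0) ≤ 1 / 2 * (1 - (1 / 2) ^ k) ∧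
      localNorm F (x 0) (x (k + 1) - x k) ≤ 1 / 4 * (1 / 2) ^ k := by
    have main : ∀ k, localNorm F (x 0) (x k - x 0) ≤ 1 / 2 * (1 - (1 / 2) ^ k) →
        localNorm F (x 0) (x (k + 1) - x k) ≤ 1 / 4 * (1 / 2) ^ k := by
      intro k hk
      have h1 : (0 : ℝ) < (1 / 2) ^ k := by positivity
      have h2 := (hF.localNorm_half_bounds hP (hxs 0) (y := x k) (by linarith)
        (x (k + 1) - x k)).1
      rw [hx k, (hP _ (hxs k)).localNorm_newtonStep_sub] at h2
      rw [hx k]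
      linarith [hdec k]
    have ind : ∀ k, localNorm F (x 0) (x k - x 0) ≤ 1 / 2 * (1 - (1 / 2) ^ k) := by
      intro k
      induction k with
      | zero => simp [localNorm_zero]
      | succ k ih =>
        have h1 := hF.localNorm_add_le (hxs 0) (hP _ (hxs 0)) (x (k + 1) - x k) (x k - x 0)
        rw [sub_add_sub_cancel] at h1
        have h2 := main k ih
        rw [pow_succ]
        linarith
    exact fun k => ⟨ind k, main k (ind k)⟩
  obtain ⟨c, hc0, hc⟩ := hF.exists_norm_le_localNorm (hxs 0) (hP _ (hxs 0))
  have hcauchy : CauchySeq x := by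
    refine cauchySeq_of_le_geometric (1 / 2) (c * (1 / 4)) (by norm_num) fun k => ?_
    rw [dist_comm, dist_eq_norm, mul_assoc]
    exact (hc _).trans (mul_le_mul_of_nonneg_left (hstep k).2 hc0)
  obtain ⟨y, hy⟩ := cauchySeq_tendsto_of_complete hcauchy
  refine ⟨y, ?_, hy⟩
  have h1 : localNorm F (x 0) (y - x 0) ≤ 1 / 2 :=
    le_of_tendsto (((continuous_localNorm F (x 0)).tendsto _).comp (hy.sub_const (x 0)))
      (Eventually.of_forall fun k => (hstep k).1.trans (by
        have : (0 : ℝ) < (1 / 2) ^ k := by positivity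
        linarith))
  have := hF.add_mem_of_localNorm_lt_one hP (hxs 0) (h1.trans_lt (by norm_num))
  rwa [add_sub_cancel] at this

theorem SelfConcordant.gradient_eq_zero_of_tendsto (hF : SelfConcordant s F)
    (hP : ∀ x ∈ s, HessPosDef F x) {x : ℕ → EuclideanSpace ℝ (Fin n)} (hxs : ∀ k, x k ∈ s)
    (hl : Tendsto (fun k => newtonDecrement F (x k)) atTop (𝓝 0))
    {y : EuclideanSpace ℝ (Fin n)} (hy : y ∈ s) (hxy : Tendsto x atTop (𝓝 y)) : ∇ F y = 0 := by
  refine ext_inner_right ℝ fun v => ?_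
  rw [inner_zero_left]
  have h1 : Tendsto (fun k => ⟪∇ F (x k), v⟫_ℝ) atTop (𝓝 ⟪∇ F y, v⟫_ℝ) :=
    ((hF.hasFDerivAt_gradient hy).continuousAt.tendsto.comp hxy).inner tendsto_const_nhds
  have h2 : Tendsto (fun k => newtonDecrement F (x k) * localNorm F (x k) v) atTop
      (𝓝 (0 * localNorm F y v)) :=
    hl.mul ((hF.continuousAt_localNorm hy v).tendsto.comp hxy)
  rw [zero_mul] at h2
  exact tendsto_nhds_unique h1 (squeeze_zero_norm
    (fun k => hF.abs_inner_gradient_le (hxs k) (hP _ (hxs k)) v) h2)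

theorem SelfConcordant.newton_quadratic_rate (hF : SelfConcordant s F)
    (hP : ∀ x ∈ s, HessPosDef F x) {x : ℕ → EuclideanSpace ℝ (Fin n)} (hxs : ∀ k, x k ∈ s)
    (hx : ∀ k, x (k + 1) = newtonStep F (x k))
    (hl : Tendsto (fun k => newtonDecrement F (x k)) atTop (𝓝 0))
    {y : EuclideanSpace ℝ (Fin n)} (hy : y ∈ s) (hg : ∇ F y = 0) (hxy : Tendsto x atTop (𝓝 y)) :
    ∃ C : ℝ, ∀ k, F (x (k + 1)) - F y ≤ C * (F (x k) - F y) ^ 2 ∧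
      ‖x (k + 1) - y‖ ≤ C * ‖x k - y‖ ^ 2 := by
  set r : ℕ → ℝ := fun k => localNorm F y (x k - y) with hrdef
  have hr0 : ∀ k, 0 ≤ r k := fun k => localNorm_nonneg _ _
  have hr : Tendsto r atTop (𝓝 0) := by
    have := ((continuous_localNorm F y).tendsto _).comp (hxy.sub_const y)
    rwa [sub_self, localNorm_zero] at this
  have hev1 : ∀ᶠ k in atTop, r k ≤ 1 / 2 := hr.eventually_le_const (by norm_num)
  have hev2 : ∀ᶠ k in atTop, newtonDecrement F (x k) ≤ 1 / 2 :=
    hl.eventually_le_const (by norm_num)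
  have hev3 : ∀ᶠ k in atTop, r (k + 1) ≤ 1 / 2 := (tendsto_add_atTop_nat 1).eventually hev1
  have hrate : ∀ᶠ k in atTop, r (k + 1) ≤ 2048 * r k ^ 2 := by
    filter_upwards [hev1, hev2, hev3] with k h1 h2 h3
    obtain ⟨-, -, h4, -⟩ := hF.local_estimates hP hy hg (hxs k) h1
    obtain ⟨-, -, -, h5⟩ := hF.local_estimates hP hy hg (hxs (k + 1)) h3
    have h6 := hF.newtonDecrement_newtonStep_le hP (hxs k) (by linarith)
    have h7 := newtonDecrement_nonneg (F := F) (x k)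
    rw [← hx k] at h6
    have h8 : newtonDecrement F (x k) / (1 - newtonDecrement F (x k)) ≤
        2 * newtonDecrement F (x k) := by
      rw [div_le_iff₀ (by linarith)]
      nlinarith
    have h9 : newtonDecrement F (x k) / (1 - newtonDecrement F (x k)) ≤ 16 * r k := by
      linarith
    have h10 := pow_le_pow_left₀ (div_nonneg h7 (by linarith)) h9 2
    change localNorm F y (x (k + 1) - y) ≤ _
    linarith [mul_pow 16 (r k) 2]
  have hfix : ∀ k, x k = y → x (k + 1) = y := fun k hk => by
    rw [hx k, hk, newtonStep_eq_self hg]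
  obtain ⟨c, hc0, hc⟩ := hF.exists_norm_le_localNorm hy (hP _ hy)
  obtain ⟨C₁, hC₁⟩ := exists_const_of_eventually_le_mul
    (a := fun k => F (x (k + 1)) - F y) (b := fun k => (F (x k) - F y) ^ 2)
    (C := 2 * 2048 ^ 2 * 64) (fun k => sq_nonneg _) (fun k hk => by
      have h1 : F (x k) ≤ F y := (sub_eq_zero.1 (pow_eq_zero_iff two_ne_zero |>.1 hk)).le
      rw [hfix k (hF.eq_of_gradient_eq_zero hP hy hg (hxs k) h1), sub_self]) (by
      filter_upwards [hev1, hev3, hrate] with k h1 h2 h3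
      obtain ⟨-, h4, -, -⟩ := hF.local_estimates hP hy hg (hxs k) h1
      obtain ⟨h5, -, -, -⟩ := hF.local_estimates hP hy hg (hxs (k + 1)) h2
      have h6 := pow_le_pow_left₀ (hr0 (k + 1)) h3 2
      have h7 := pow_le_pow_left₀ (sq_nonneg _) h4 2
      calc _ ≤ _ := h5
        _ ≤ 2 * (2048 * r k ^ 2) ^ 2 := by linarith
        _ = 2 * 2048 ^ 2 * (r k ^ 2) ^ 2 := by ring
        _ ≤ 2 * 2048 ^ 2 * (8 * (F (x k) - F y)) ^ 2 := by gcongr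
        _ = _ := by ring)
  obtain ⟨C₂, hC₂⟩ := exists_const_of_eventually_le_mul
    (a := fun k => ‖x (k + 1) - y‖) (b := fun k => ‖x k - y‖ ^ 2)
    (C := c * (2048 * √‖hess F y‖ ^ 2)) (fun k => sq_nonneg _) (fun k hk => by
      have h1 : x k = y := sub_eq_zero.1 (norm_eq_zero.1 (pow_eq_zero_iff two_ne_zero |>.1 hk))
      rw [hfix k h1, sub_self, norm_zero]) (by
      filter_upwards [hrate] with k h3
      calc _ ≤ c * r (k + 1) := hc _
        _ ≤ c * (2048 * (√‖hess F y‖ * ‖x k - y‖) ^ 2) := by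
          gcongr
          refine h3.trans ?_
          gcongr
          · exact hr0 k
          · exact localNorm_le_norm F y _
        _ = _ := by ring)
  exact ⟨max C₁ C₂, fun k => ⟨(hC₁ k).trans (by gcongr; exact le_max_left _ _),
    (hC₂ k).trans (by gcongr; exact le_max_right _ _)⟩⟩

end SelfConc

theorem theorem23 (n : ℕ) (s : Set (EuclideanSpace ℝ (Fin n)))
    (F : EuclideanSpace ℝ (Fin n) → ℝ) (hF : SelfConc.SelfConcordant s F)
    (hnd : SelfConc.ContainsNoLine s ∨ ∀ x ∈ s, SelfConc.HessPosDef F x) :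
    -- the Hessian is positive definite, so that its inverse is meaningful
    (∀ x ∈ s, SelfConc.HessPosDef F x) ∧
    -- one full Newton step
    (∀ x ∈ s, SelfConc.newtonDecrement F x < 1 →
      SelfConc.newtonStep F x ∈ s ∧
      SelfConc.newtonDecrement F (SelfConc.newtonStep F x) ≤
        (SelfConc.newtonDecrement F x / (1 - SelfConc.newtonDecrement F x)) ^ 2) ∧
    -- quadratic convergence of the Newton method in the region `λ < (3 - √5) / 2`
    (∀ x₀ ∈ s, SelfConc.newtonDecrement F x₀ < (3 - √5) / 2 →
      ∀ x : ℕ → EuclideanSpace ℝ (Fin n), x 0 = x₀ →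
      (∀ k, x (k + 1) = SelfConc.newtonStep F (x k)) →
      (∀ k, x k ∈ s ∧
        SelfConc.newtonDecrement F (x k) < (3 - √5) / 2 ∧
        SelfConc.newtonDecrement F (x (k + 1)) ≤
          (SelfConc.newtonDecrement F (x k) / (1 - SelfConc.newtonDecrement F (x k))) ^ 2 ∧
        SelfConc.newtonDecrement F (x (k + 1)) ≤
          SelfConc.newtonDecrement F (x k) ^ 2 / (1 - SelfConc.newtonDecrement F x₀) ^ 2 ∧
        (0 < SelfConc.newtonDecrement F (x k) →
          SelfConc.newtonDecrement F (x (k + 1)) < SelfConc.newtonDecrement F (x k))) ∧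
      Tendsto (fun k => SelfConc.newtonDecrement F (x k)) atTop (𝓝 0) ∧
      ∃ xs ∈ s, IsMinOn F s xs ∧ (∀ y ∈ s, IsMinOn F s y → y = xs) ∧
        Tendsto x atTop (𝓝 xs) ∧
        Tendsto (fun k => F (x k)) atTop (𝓝 (F xs)) ∧
        ∃ C : ℝ, ∀ k,
          F (x (k + 1)) - F xs ≤ C * (F (x k) - F xs) ^ 2 ∧
          ‖x (k + 1) - xs‖ ≤ C * ‖x k - xs‖ ^ 2) := by

  have hP : ∀ x ∈ s, SelfConc.HessPosDef F x :=
    hnd.elim (fun h x hx => hF.hessPosDef_of_containsNoLine h hx) id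
  refine ⟨hP, fun x hx hl =>
    ⟨hF.newtonStep_mem hP hx hl, hF.newtonDecrement_newtonStep_le hP hx hl⟩, ?_⟩
  rintro x₀ hx₀ hl x rfl hx
  have hit := hF.newton_iterates_decrement hP hx₀ hl hx
  have hlim := hF.tendsto_newtonDecrement hP hx₀ hl hx
  have hmem : ∀ k, x k ∈ s := fun k => (hit k).1
  refine ⟨fun k => ?_, hlim, ?_⟩
  · obtain ⟨h1, h2, h3, h4⟩ := hit k
    refine ⟨h1, h2.trans_lt hl, h3, h4, fun hpos => h3.trans_lt ?_⟩
    have h5 := SelfConc.lt_one_sub_sq_of_lt_threshold (h2.trans_lt hl)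
    rw [div_pow, div_lt_iff₀ (hpos.trans h5), sq]
    exact mul_lt_mul_of_pos_left h5 hpos
  · obtain ⟨K, hK⟩ := (hlim.eventually_le_const (by norm_num : (0 : ℝ) < 1 / 8)).exists
    obtain ⟨y, hy, hKy⟩ := hF.exists_tendsto_newton hP (x := fun k => x (k + K))
      (fun k => hmem _) (by simpa using hK) (fun k => by
        rw [Nat.add_right_comm]; exact hx _)
    have hxy : Tendsto x atTop (𝓝 y) := (tendsto_add_atTop_iff_nat K).1 hKy
    have hg := hF.gradient_eq_zero_of_tendsto hP hmem hlim hy hxy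
    exact ⟨y, hy, hF.isMinOn_of_gradient_eq_zero hy hg,
      fun z hz hmin => hF.eq_of_gradient_eq_zero hP hy hg hz (hmin hy), hxy,
      (hF.contDiffAt hy).continuousAt.tendsto.comp hxy,
      hF.newton_quadratic_rate hP hmem hx hlim hy hg hxy⟩
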